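/- All rings are commutative with unity. Let $U$ be a poset. The dimension $\dim U$ is the supremum of the lengths of chains in $U$; for $u \in U$ put $L(u)=\{v\in U: v\le u\}$, $G(u)=\{v\in U : v\ge u\}$, $L(u)^*=L(u)\setminus\{u\}$, $G(u)^*=G(u)\setminus\{u\}$ and $\operatorname{ht} u=\dim L(u)$, and let $H_i$ be the set of nodes of height $i$. For nodes $u,w$ let $[u/w]$ be the set of all nodes $x$ with $G(x)^*=\{u\}$ and $L(x)^*=\{w\}$. The sets of minimal and of maximal nodes of $U$ are denoted $\min U$ and $\max U$. A poset $U$ with $\dim U\le 2$ is a $K$-poset if (1) $\min U$ and $H_2$ are finite; (2) for any distinct $u,v\in\min U$ the set of minimal elements of $\{x\in U: x\ge u,\ x\ge v\}$ is finite; and (3) whenever $u>v>w$ in $U$, the set $[u/w]$ is infinite. It is proper if moreover $|[u/w]|=0$ or $|[u/w]|=|U|$ for every maximal node $u$ and every minimal node $w$. For a poset $V$ with a single maximal node $m$ and $\dim V \geq 1$, let $\mathcal H_V$ consist of the minimal nodes of $V$ together with the height one nodes of $V$ that dominate at least two minimal nodes, let $\mathcal H_V^*=\mathcal H_V\setminus\{m\}$,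 let $\Lambda_V\subseteq \mathcal H_V^*$ be the set of those $v\in\mathcal H_V^*$ such that $v \in H_1$ or $G(v)\cap H_1\cap\mathcal H_V^*=\emptyset$, and let $d_V(m)=|\Lambda_V|$. A proper $K$-poset $U$ is simple if $d_{L(m)}(m)=1$ for every maximal node $m$ of $U$ of positive height. A poset $U$ is said to be the spectrum of a Noetherian ring with common residue field $k$ if there is a Noetherian ring $R$ such that $\operatorname{Spec} R$, ordered by inclusion, is isomorphic to $U$ as a poset and $R/M\cong k$ for every maximal ideal $M$ of $R$. **Theorem.** Let $\beta$ be a cardinal number and let $k$ be a field. Suppose that every proper, simple $K$-poset $U$ with $|U|=\beta$ and $|\max U|<\infty$ is the spectrum of a Noetherian ring with common residue field $k$. Then every proper $K$-poset $V$ with $|V|=\beta$ and $|\max V|<\infty$ is the spectrum of a Noetherian ring with common residue field $k$. -/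

import Mathlib

universe u v w

namespace KPoset

open Order

/-- The intersection class `[B/C]`: all nodes `x` whose set of strictly larger nodes is `B`
and whose set of strictly smaller nodes is `C`. -/
def interClass {U : Type u} [PartialOrder U] (B C : Set U) : Set U :=
  {x | Set.Ioi x = B ∧ Set.Iio x = C}

/-- The set `mub A` of minimal upper bounds of `A`. -/
def mub {U : Type u} [PartialOrder U] (A : Set U) : Set U :=
  {x | Minimal (fun y => y ∈ upperBounds A) x}

/-- `K`-posets. The height `Order.height x` is the supremum of the lengths of the chains
in `Set.Iic x`. -/
structure IsKPoset (U : Type u) [PartialOrder U] : Prop where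
  dim_le : krullDim U ≤ 2
  finite_min : {x : U | IsMin x}.Finite
  finite_height_two : {x : U | height x = 2}.Finite
  finite_mub : ∀ x y : U, IsMin x → IsMin y → x ≠ y → (mub {x, y}).Finite
  infinite_class : ∀ x y z : U, z < y → y < x → (interClass {x} {z}).Infinite

/-- Proper `K`-posets: each class `[x/z]`, with `x` maximal and `z` minimal, is empty or has the
cardinality of the whole poset. -/
structure IsProperKPoset (U : Type u) [PartialOrder U] : Prop extends IsKPoset U where
  class_card : ∀ x z : U, IsMax x → IsMin z →
    Cardinal.mk (interClass {x} {z}) = 0 ∨ Cardinal.mk (interClass {x} {z}) = Cardinal.mk U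

/-- The set `H_U` of all minimal nodes of `U`, along with those nodes of height one that
dominate at least two minimal nodes. -/
def hNodes (U : Type u) [PartialOrder U] : Set U :=
  {x | IsMin x ∨ (height x = 1 ∧ ∃ a b : U, a ≠ b ∧ IsMin a ∧ IsMin b ∧ a < x ∧ b < x)}

/-- `H_V^*`, the set `H_V` without `m`, where `m` is the single maximal node of `V`. -/
def hNodesStar {V : Type u} [PartialOrder V] (m : V) : Set V :=
  hNodes V \ {m}

/-- The subset `Λ_V` of `H_V^*`: the nodes of height one in `H_V^*`, along with the nodes
that have no node of height one of `H_V^*` above them. Here `m` is the single maximal node of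
`V`. -/
def lambdaNodes {V : Type u} [PartialOrder V] (m : V) : Set V :=
  {x | x ∈ hNodesStar m ∧
    (height x = 1 ∨ Set.Ici x ∩ {y | height y = 1} ∩ hNodesStar m = ∅)}

/-- The quantity `d_V(m)`, for a poset `V` with a single maximal node `m`. -/
noncomputable def dNumber {V : Type u} [PartialOrder V] (m : V) : Cardinal.{u} :=
  Cardinal.mk (lambdaNodes m)

/-- Proper, simple `K`-posets: `d_{L(m)}(m) = 1` for every maximal node `m` of positive height,
where `L(m) = Set.Iic m` is the poset of all nodes below `m`. -/
structure IsSimpleProperKPoset (U : Type u) [PartialOrder U] : Prop extends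
    IsProperKPoset U where
  d_eq_one : ∀ m : U, IsMax m → 0 < height m →
    dNumber (⟨m, Set.mem_Iic.mpr le_rfl⟩ : Set.Iic m) = 1

/-- `U` is isomorphic, as a poset, to the prime spectrum (ordered by inclusion) of a commutative
Noetherian ring all of whose residue fields at maximal ideals are isomorphic to `k`. -/
def IsNoetherianSpectrum.{r, s, t} (U : Type s) [PartialOrder U] (k : Type t) [Field k] : Prop :=
  ∃ (R : Type r) (_ : CommRing R), IsNoetherianRing R ∧
    Nonempty (PrimeSpectrum R ≃o U) ∧
    ∀ M : Ideal R, M.IsMaximal → Nonempty ((R ⧸ M) ≃+* k)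

end KPoset

/-!
The idea is to undo the failure of simplicity by splitting maximal nodes, and to recover the
original poset from the split one by gluing maximal ideals.

*Gluing.* Let `R` be Noetherian with finitely many maximal ideals, all with residue field `k`, and
let an equivalence relation on the maximal ideals be given. After choosing a map `R → k` for each
maximal ideal, the elements of `R` on which equivalent maps agree form a subring `A`. It contains
the Jacobson radical of `R`, and `R` is finite over `A`, so `A` is Noetherian
(`isNoetherianRing_of_finite_of_conductor`) and, by going up and the Chinese remainder theorem,
`Spec A` is `Spec R` with equivalent maximal ideals identified. The residue fields of `A` are again
`k`. In terms of posets this is `IsNoetherianSpectrum.of_glue`.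

*Splitting.* Let `V` be an infinite proper `K`-poset and `m` a maximal node of positive height. The
elements of `Λ` for `m` are called `branches m`; `m` is replaced by one node `(m, l)` for each
branch `l`. Below `(m, l)` are placed the nodes below or equal to `l`, together with some of the
nodes below `m` that dominate only one minimal node `a ≤ l`. The latter are distributed so that
every class `[m/a]` is shared out into parts of full cardinality (`IsDistribution`); this is
possible because there are finitely many branches and a nonempty class has the infinite cardinality
of `V`. The result is proper and simple (`Split.isSimpleProperKPoset`), has as many nodes as `V`,
and glues to `V`.

*Finite posets.* A finite `K`-poset `V` has dimension at most one, and it is glued from the disjoint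
union of the sets `Set.Ici a` with `a` minimal. Adding isolated nodes to `Set.Ici a` gives a simple
`K`-poset on the nodes of `V` itself (`Star`). The hypothesis realizes it by a ring; a quotient by a
prime ideal realizes `Set.Ici a`, and a finite product of rings realizes the disjoint union.
-/

namespace KPoset

/-! ### Gluing points: the subring and its finiteness -/

/-- A special case of the Eakin–Nagata theorem: Noetherianity descends along a finite extension
`A ⊆ R` if `A` contains an ideal `J` of `R` (the hypothesis `hJ`) with `A ⧸ J` Noetherian. For an
ideal `I` of `A`, the ideal `I R` is generated by finitely many `xᵢ ∈ I`. Let `N = ∑ A xᵢ ⊆ I`.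
Then `I R / N` is a finite `A`-module killed by `J`, hence Noetherian, and it contains `I / N`. -/
theorem isNoetherianRing_of_finite_of_conductor {A R : Type*} [CommRing A] [CommRing R]
    [Algebra A R] [IsNoetherianRing R] [Module.Finite A R]
    (hinj : Function.Injective (algebraMap A R)) (J : Ideal A)
    (hJ : ∀ j ∈ J, ∀ r : R, ∃ a : A, algebraMap A R a = algebraMap A R j * r)
    [IsNoetherian A (A ⧸ J)] : IsNoetherianRing A := by
  refine ⟨fun I => ?_⟩
  have hlin : Function.Injective (Algebra.linearMap A R) := hinj
  refine Submodule.fg_of_fg_map_injective (Algebra.linearMap A R) hlin ?_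
  obtain ⟨s, hsI, hs⟩ : ∃ s : Finset R, (s : Set R) ⊆ algebraMap A R '' I ∧
      Ideal.span (algebraMap A R '' I) = Ideal.span (s : Set R) :=
    Submodule.fg_span_iff_fg_span_finset_subset _ |>.1 (IsNoetherian.noetherian _)
  obtain ⟨t, ht⟩ := Module.Finite.fg_top (R := A) (M := R)
  set N : Submodule A R := Submodule.span A (s : Set R) with hN
  have hNI : N ≤ I.map (Algebra.linearMap A R) := by
    rw [hN, Submodule.span_le]
    intro x hx
    obtain ⟨a, ha, rfl⟩ := hsI hx
    exact ⟨a, ha, rfl⟩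
  refine Submodule.fg_of_fg_map_of_fg_inf_ker N.mkQ ?_ ?_
  swap
  · rw [Submodule.ker_mkQ, inf_eq_right.2 hNI]
    exact ⟨s, rfl⟩
  let L : R → A →ₗ[A] (R ⧸ N) := fun b => LinearMap.toSpanSingleton A (R ⧸ N) (N.mkQ b)
  have hL : ∀ p : s × t, IsNoetherian A (LinearMap.range (L (p.1.1 * p.2.1))) := by
    rintro ⟨⟨x, hx⟩, ⟨y, hy⟩⟩
    have hker : J ≤ LinearMap.ker (L (x * y)) := by
      intro j hj
      obtain ⟨a, ha⟩ := hJ j hj y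
      simp only [L, LinearMap.mem_ker, LinearMap.toSpanSingleton_apply, ← map_smul]
      rw [Submodule.mkQ_apply, Submodule.Quotient.mk_eq_zero]
      have : j • (x * y) = a • x := by
        rw [Algebra.smul_def, Algebra.smul_def, ha]; ring
      rw [this]
      exact N.smul_mem _ (Submodule.subset_span hx)
    have : LinearMap.range (L (x * y)) = LinearMap.range (Submodule.liftQ J (L (x * y)) hker) := by
      rw [Submodule.range_liftQ]
    rw [this]
    infer_instance
  have hfin : IsNoetherian A (⨆ p : s × t, LinearMap.range (L (p.1.1 * p.2.1)) :
      Submodule A (R ⧸ N)) := isNoetherian_iSup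
  have hle : (I.map (Algebra.linearMap A R)).map N.mkQ ≤
      ⨆ p : s × t, LinearMap.range (L (p.1.1 * p.2.1)) := by
    rw [Submodule.map_le_iff_le_comap]
    have hmem : ∀ x ∈ s, ∀ r : R, x * r ∈ Submodule.comap N.mkQ
        (⨆ p : s × t, LinearMap.range (L (p.1.1 * p.2.1))) := by
      intro x hx r
      have hr : r ∈ Submodule.span A (t : Set R) := by rw [ht]; trivial
      induction hr using Submodule.span_induction with
      | mem y hy =>
        refine Submodule.mem_iSup_of_mem (⟨⟨x, hx⟩, ⟨y, hy⟩⟩ : s × t) ⟨1, ?_⟩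
        simp [L]
      | zero => simp
      | add y z _ _ hy hz => rw [mul_add]; exact Submodule.add_mem _ hy hz
      | smul c y _ hy => rw [mul_smul_comm]; exact Submodule.smul_mem _ c hy
    rintro _ ⟨a, ha, rfl⟩
    have h1 : algebraMap A R a ∈ Ideal.span (s : Set R) :=
      hs ▸ Ideal.subset_span ⟨a, ha, rfl⟩
    change algebraMap A R a ∈ _
    generalize algebraMap A R a = z at h1
    refine Submodule.span_induction (p := fun z _ => ∀ r : R, z * r ∈ Submodule.comap N.mkQ
        (⨆ p : s × t, LinearMap.range (L (p.1.1 * p.2.1)))) (fun x hx r => hmem x hx r)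
        (fun r => by simp) (fun x y _ _ hx hy r => ?_) (fun c x _ hx r => ?_) h1 1 |> fun h => by
          simpa using h
    · rw [add_mul]; exact Submodule.add_mem _ (hx r) (hy r)
    · rw [smul_eq_mul, mul_comm c, mul_assoc]; exact hx _
  have := isNoetherian_of_le hle
  exact (Submodule.fg_top _).1 (this.noetherian ⊤)

/-- The subring of those elements of `R` on which the maps `φ i` agree along the fibres of `c`. -/
def gluedSubring {ι X R k : Type*} [CommRing R] [Field k] (φ : ι → R →+* k) (c : ι → X) :
    Subring R where
  carrier := {r | ∀ i j, c i = c j → φ i r = φ j r}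
  mul_mem' ha hb i j h := by rw [map_mul, map_mul, ha i j h, hb i j h]
  one_mem' i j _ := by rw [map_one, map_one]
  add_mem' ha hb i j h := by rw [map_add, map_add, ha i j h, hb i j h]
  zero_mem' i j _ := by rw [map_zero, map_zero]
  neg_mem' ha i j h := by rw [map_neg, map_neg, ha i j h]

section Glue

variable {ι X R k : Type*} [CommRing R] [Field k] (φ : ι → R →+* k) (c : ι → X)

theorem mem_gluedSubring {r : R} :
    r ∈ gluedSubring φ c ↔ ∀ i j, c i = c j → φ i r = φ j r := Iff.rfl

/-- As an `A`-module, `R` is generated by `1` and by lifts of the coordinate idempotents of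
`ι → k`: these span `R` modulo the common kernel of the `φ i`, which is contained in `A`. -/
theorem finite_gluedSubring [Finite ι] (hφ : ∀ g : ι → k, ∃ r, ∀ i, φ i r = g i) :
    Module.Finite (gluedSubring φ c) R := by
  classical
  have := Fintype.ofFinite ι
  choose e he using fun i : ι => hφ (Pi.single i 1)
  refine ⟨⟨insert 1 (Finset.univ.image e), ?_⟩⟩
  rw [eq_top_iff]
  rintro r -
  choose b hb using fun i : ι => hφ (fun _ => φ i r)
  have hbA : ∀ i, b i ∈ gluedSubring φ c := fun i j l _ => by rw [hb, hb]
  -- the remainder lies in the common kernel of the `φ i`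
  set z := r - ∑ i, b i * e i with hz
  have hzA : z ∈ gluedSubring φ c := by
    have : ∀ j, φ j z = 0 := by
      intro j
      simp only [hz, map_sub, map_sum, map_mul, hb, he]
      simp [Pi.single_apply]
    intro i j _
    rw [this, this]
  have hr : r = (⟨z, hzA⟩ : gluedSubring φ c) • (1 : R) +
      ∑ i, (⟨b i, hbA i⟩ : gluedSubring φ c) • e i := by
    simp [Subring.smul_def, hz]
  rw [hr]
  refine Submodule.add_mem _ (Submodule.smul_mem _ _ (Submodule.subset_span (by simp)))
    (Submodule.sum_mem _ fun i _ => Submodule.smul_mem _ _ (Submodule.subset_span (by simp)))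

theorem isNoetherianRing_gluedSubring [Finite ι] [IsNoetherianRing R]
    (hφ : ∀ g : ι → k, ∃ r, ∀ i, φ i r = g i) : IsNoetherianRing (gluedSubring φ c) := by
  have := finite_gluedSubring φ c hφ
  set A := gluedSubring φ c
  let ψ : ι → A →+* k := fun i => (φ i).comp A.subtype
  have hψ : ∀ i, Function.Surjective (ψ i) := by
    intro i x
    obtain ⟨r, hr⟩ := hφ fun _ => x
    exact ⟨⟨r, fun a b _ => by rw [hr, hr]⟩, hr i⟩
  let Φ : A →ₗ[A] (∀ i, A ⧸ RingHom.ker (ψ i)) :=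
    LinearMap.pi fun i => Submodule.mkQ (RingHom.ker (ψ i))
  have h1 : ∀ i, IsNoetherian A (A ⧸ RingHom.ker (ψ i)) := by
    intro i
    have hm : (RingHom.ker (ψ i)).IsMaximal := RingHom.ker_isMaximal_of_surjective _ (hψ i)
    have : IsSimpleModule A (A ⧸ RingHom.ker (ψ i)) := isSimpleModule_iff_isCoatom.2 hm.out
    infer_instance
  have h2 : IsNoetherian A (A ⧸ LinearMap.ker Φ) :=
    isNoetherian_of_injective (Submodule.liftQ (LinearMap.ker Φ) Φ le_rfl)
      (LinearMap.ker_eq_bot.1 (Submodule.ker_liftQ_eq_bot _ _ _ le_rfl))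
  refine isNoetherianRing_of_finite_of_conductor (A := A) (R := R)
    Subtype.val_injective (LinearMap.ker Φ) ?_
  intro j hj r
  have hj0 : ∀ i, φ i j = 0 := by
    intro i
    have := congrFun (LinearMap.mem_ker.1 hj) i
    exact (Ideal.Quotient.eq_zero_iff_mem (I := RingHom.ker (ψ i))).1 this
  exact ⟨⟨j * r, fun a b _ => by simp [hj0]⟩, rfl⟩

end Glue

/-! ### The spectrum of the glued subring -/

section Glue

variable {X R k : Type*} [CommRing R] [Field k]

theorem exists_ringHom_ker_eq {M : Ideal R} (h : Nonempty ((R ⧸ M) ≃+* k)) :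
    ∃ φ : R →+* k, Function.Surjective φ ∧ RingHom.ker φ = M := by
  obtain ⟨e⟩ := h
  refine ⟨e.toRingHom.comp (Ideal.Quotient.mk M),
    e.surjective.comp Ideal.Quotient.mk_surjective, ?_⟩
  ext x
  simp [RingHom.mem_ker, Ideal.Quotient.eq_zero_iff_mem]

theorem nonempty_ringEquiv_of_ker_eq {M : Ideal R} (φ : R →+* k) (hφ : Function.Surjective φ)
    (h : RingHom.ker φ = M) : Nonempty ((R ⧸ M) ≃+* k) := by
  subst h
  exact ⟨RingHom.quotientKerEquivOfSurjective hφ⟩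

/-- The Chinese remainder theorem for maps onto a field with distinct kernels. -/
theorem exists_forall_map_eq {ι : Type*} [Finite ι] (φ : ι → R →+* k)
    (hφ : ∀ i, Function.Surjective (φ i)) (hker : Function.Injective fun i => RingHom.ker (φ i))
    (g : ι → k) : ∃ r, ∀ i, φ i r = g i := by
  choose x hx using fun i => hφ i (g i)
  have hm : ∀ i, (RingHom.ker (φ i)).IsMaximal := fun i =>
    RingHom.ker_isMaximal_of_surjective _ (hφ i)
  obtain ⟨r, hr⟩ := Ideal.exists_forall_sub_mem_ideal (I := fun i => RingHom.ker (φ i))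
    (fun i j hij => Ideal.isCoprime_of_isMaximal fun h => hij (hker h)) x
  refine ⟨r, fun i => ?_⟩
  have := hr i
  rw [RingHom.mem_ker, map_sub, sub_eq_zero] at this
  rw [this, hx]

section Spec

variable {ι : Type*} (m : ι → PrimeSpectrum R) (φ : ι → R →+* k) (c : ι → X)
  (hker : ∀ i, RingHom.ker (φ i) = (m i).asIdeal)

include hker in
/-- The glued subring contains the intersection of the finitely many maximal ideals `m i`, so
contraction to it reflects inclusions into a prime that contains none of them. -/
theorem le_of_comap_gluedSubring_le [Finite ι] {P Q : PrimeSpectrum R}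
    (hQ : ∀ i, ¬ m i ≤ Q)
    (h : P.asIdeal.comap (gluedSubring φ c).subtype ≤ Q.asIdeal.comap (gluedSubring φ c).subtype) :
    P ≤ Q := by
  have := Fintype.ofFinite ι
  have hJ : ¬ (Finset.univ.inf fun i => (m i).asIdeal) ≤ Q.asIdeal := by
    rw [Q.isPrime.inf_le']
    rintro ⟨i, -, hi⟩
    exact hQ i hi
  obtain ⟨j, hj, hjQ⟩ := SetLike.not_le_iff_exists.1 hJ
  have hj0 : ∀ i, φ i j = 0 := fun i => by
    have := (Finset.inf_le (f := fun i => (m i).asIdeal) (Finset.mem_univ i)) hj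
    rw [← hker i] at this
    exact this
  intro p hp
  have hpj : p * j ∈ gluedSubring φ c := fun a b _ => by simp [hj0]
  have : (⟨p * j, hpj⟩ : gluedSubring φ c) ∈ Q.asIdeal.comap (gluedSubring φ c).subtype :=
    h (Ideal.mul_mem_right _ _ hp)
  exact (Q.isPrime.mem_or_mem this).resolve_right hjQ

include hker in
theorem comap_gluedSubring_eq {i j : ι} (h : c i = c j) :
    (m i).asIdeal.comap (gluedSubring φ c).subtype =
      (m j).asIdeal.comap (gluedSubring φ c).subtype := by
  ext ⟨a, ha⟩
  simp only [Ideal.mem_comap, Subring.subtype_apply, ← hker, RingHom.mem_ker]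
  rw [ha i j h]

include hker in
theorem eq_of_comap_gluedSubring_le (hφ : ∀ g : ι → k, ∃ r, ∀ i, φ i r = g i) {i j : ι}
    (h : (m i).asIdeal.comap (gluedSubring φ c).subtype ≤
      (m j).asIdeal.comap (gluedSubring φ c).subtype) : c i = c j := by
  classical
  by_contra hij
  -- an element that vanishes at exactly those points that are not glued to `m j`
  obtain ⟨r, hr⟩ := hφ fun l => if c l = c j then 1 else 0
  have hrA : r ∈ gluedSubring φ c := fun a b hab => by rw [hr, hr, hab]
  have h1 : (⟨r, hrA⟩ : gluedSubring φ c) ∈ (m i).asIdeal.comap (gluedSubring φ c).subtype := by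
    simp [← hker, RingHom.mem_ker, hr, hij]
  have h2 := h h1
  simp [← hker, RingHom.mem_ker, hr] at h2

end Spec

end Glue

/-- Gluing maximal ideals with a common residue field: if finitely many maximal nodes of `U` are
identified by a suitable surjection `f : U → V`, the spectrum property passes from `U` to `V`. -/
theorem IsNoetherianSpectrum.of_glue {U V : Type u} [PartialOrder U] [PartialOrder V]
    {k : Type v} [Field k] (hU : IsNoetherianSpectrum.{w} U k) (hfin : {x : U | IsMax x}.Finite)
    (f : U → V) (hmono : Monotone f) (hsurj : Function.Surjective f)
    (hlift : ∀ x y, f x ≤ f y → ∃ y', x ≤ y' ∧ f y' = f y)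
    (hfib : ∀ x y, f x = f y → x = y ∨ (IsMax x ∧ IsMax y)) :
    IsNoetherianSpectrum.{w} V k := by
  obtain ⟨R, _, hR, ⟨e⟩, hk⟩ := hU
  let ι := {p : PrimeSpectrum R // IsMax p}
  have hι : Finite ι :=
    (hfin.preimage e.injective.injOn).subset fun p (hp : IsMax p) => e.isMax_apply.2 hp
  have hmax : ∀ i : ι, i.1.asIdeal.IsMaximal := fun i => PrimeSpectrum.isMax_iff.1 i.2
  choose φ hφ hker using fun i : ι => exists_ringHom_ker_eq (hk i.1.asIdeal (hmax i))
  have hcrt := exists_forall_map_eq φ hφ fun i j hij =>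
    Subtype.ext (PrimeSpectrum.ext (by simpa only [hker] using hij))
  let c : ι → V := fun i => f (e i.1)
  let A := gluedSubring φ c
  have hfinite : Module.Finite A R := finite_gluedSubring φ c hcrt
  have hint : Algebra.IsIntegral A R := inferInstance
  have hnoeth : IsNoetherianRing A := isNoetherianRing_gluedSubring φ c hcrt
  let F : PrimeSpectrum R → PrimeSpectrum A := PrimeSpectrum.comap A.subtype
  have hFsurj : Function.Surjective F := by
    intro p
    obtain ⟨Q, -, hQ, hQp⟩ := Ideal.exists_ideal_over_prime_of_isIntegral (S := R) p.asIdeal ⊥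
      (by
        intro x hx
        have : x = 0 := Subtype.ext hx
        rw [this]; exact Ideal.zero_mem _)
    exact ⟨⟨Q, hQ⟩, PrimeSpectrum.ext hQp⟩
  have hiff : ∀ P Q : PrimeSpectrum R, F P ≤ F Q ↔ f (e P) ≤ f (e Q) := by
    intro P Q
    constructor
    · intro h
      -- going up produces a prime above `P` that is glued to `Q`
      by_cases hQ : IsMax Q
      · obtain ⟨Q', hPQ', hQ'prime, hQ'⟩ :=
          Ideal.exists_ideal_over_prime_of_isIntegral (F Q).asIdeal P.asIdeal h
        have hQ'max : IsMax (⟨Q', hQ'prime⟩ : PrimeSpectrum R) := by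
          have := hmax ⟨Q, hQ⟩
          have h3 : (Q'.comap (algebraMap A R)).IsMaximal := by
            rw [hQ']
            exact Ideal.isMaximal_comap_of_isIntegral_of_isMaximal (R := A) Q.asIdeal
          exact PrimeSpectrum.isMax_iff.2
            (Ideal.isMaximal_of_isIntegral_of_isMaximal_comap (R := A) Q' h3)
        have h4 : c ⟨_, hQ'max⟩ = c ⟨Q, hQ⟩ :=
          eq_of_comap_gluedSubring_le (fun i : ι => i.1) φ c hker hcrt (le_of_eq hQ')
        calc f (e P) ≤ f (e ⟨Q', hQ'prime⟩) := hmono (e.monotone hPQ')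
          _ = f (e Q) := h4
      · refine hmono (e.monotone ?_)
        exact le_of_comap_gluedSubring_le (fun i : ι => i.1) φ c hker
          (fun i hi => hQ ((le_antisymm hi (i.2 hi)) ▸ i.2)) h
    · intro h
      obtain ⟨y, hy, hyQ⟩ := hlift _ _ h
      have h1 : F P ≤ F (e.symm y) := 
        Ideal.comap_mono (show P.asIdeal ≤ (e.symm y).asIdeal from e.le_symm_apply.2 hy)
      refine h1.trans (le_of_eq ?_)
      rcases hfib _ _ hyQ with rfl | ⟨hy1, hy2⟩
      · simp
      · refine PrimeSpectrum.ext (comap_gluedSubring_eq (fun i : ι => i.1) φ c hker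
          (i := ⟨e.symm y, e.symm.isMax_apply.2 hy1⟩) (j := ⟨Q, e.isMax_apply.1 hy2⟩) ?_)
        simpa [c] using hyQ
  refine ⟨A, inferInstance, hnoeth, ⟨?_⟩, ?_⟩
  · choose s hs using hFsurj
    have hle : ∀ a b, f (e (s a)) ≤ f (e (s b)) ↔ a ≤ b := fun a b => by rw [← hiff, hs, hs]
    refine RelIso.ofSurjective (OrderEmbedding.ofMapLEIff _ hle) fun x => ?_
    obtain ⟨u, rfl⟩ := hsurj x
    obtain ⟨P, rfl⟩ := e.surjective u
    -- `s (F P)` need not be `P`, but it contracts to the same prime and so has the same image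
    refine ⟨F P, le_antisymm ?_ ?_⟩
    · exact (hiff _ _).1 (hs _).le
    · exact (hiff _ _).1 (hs _).ge
  · intro M hM
    obtain ⟨Q, hQ⟩ := hFsurj ⟨M, hM.isPrime⟩
    have hQM : Q.asIdeal.comap A.subtype = M := congrArg PrimeSpectrum.asIdeal hQ
    have hQmax : IsMax Q := PrimeSpectrum.isMax_iff.2
      (Ideal.isMaximal_of_isIntegral_of_isMaximal_comap (R := A) Q.asIdeal (by
        change (Q.asIdeal.comap A.subtype).IsMaximal
        rwa [hQM]))
    refine nonempty_ringEquiv_of_ker_eq ((φ ⟨Q, hQmax⟩).comp A.subtype) ?_ ?_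
    · intro x
      obtain ⟨r, hr⟩ := hcrt fun _ => x
      exact ⟨⟨r, fun a b _ => by rw [hr, hr]⟩, hr _⟩
    · rw [← hQM, ← RingHom.comap_ker, hker]

/-! ### Upper sets and finite disjoint unions of spectra -/

theorem IsNoetherianSpectrum.congr {U V : Type*} [PartialOrder U] [PartialOrder V]
    {k : Type v} [Field k] (hU : IsNoetherianSpectrum.{w} U k) (e : U ≃o V) :
    IsNoetherianSpectrum.{w} V k := by
  obtain ⟨R, _, hR, ⟨f⟩, hk⟩ := hU
  exact ⟨R, inferInstance, hR, ⟨f.trans e⟩, hk⟩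

/-- The upper set of a node is the spectrum of a quotient by a prime ideal. -/
theorem IsNoetherianSpectrum.Ici {U : Type*} [PartialOrder U]
    {k : Type v} [Field k] (hU : IsNoetherianSpectrum.{w} U k) (a : U) :
    IsNoetherianSpectrum.{w} (Set.Ici a) k := by
  obtain ⟨R, _, hR, ⟨f⟩, hk⟩ := hU
  set I := (f.symm a).asIdeal
  refine ⟨R ⧸ I, inferInstance, inferInstance,
    ⟨I.primeSpectrumQuotientOrderIsoZeroLocus.trans ?_⟩, ?_⟩
  · refine
      { toFun := fun p => ⟨f p.1, f.symm_apply_le.1 p.2⟩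
        invFun := fun x => ⟨f.symm x.1, f.symm.monotone x.2⟩
        left_inv := fun p => by simp
        right_inv := fun p => by simp
        map_rel_iff' := fun {p q} => f.le_iff_le }
  · intro M hM
    have hM' : (M.comap (Ideal.Quotient.mk I)).IsMaximal :=
      Ideal.comap_isMaximal_of_surjective _ Ideal.Quotient.mk_surjective
    obtain ⟨φ, hφ, hker⟩ := exists_ringHom_ker_eq (hk _ hM')
    have hI : I ≤ RingHom.ker φ := by
      rw [hker]
      intro x hx
      simp [Ideal.mem_comap, Ideal.Quotient.eq_zero_iff_mem.2 hx]
    refine nonempty_ringEquiv_of_ker_eq (Ideal.Quotient.lift I φ hI)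
      (Ideal.Quotient.lift_surjective_of_surjective I hI hφ) ?_
    ext x
    obtain ⟨x, rfl⟩ := Ideal.Quotient.mk_surjective x
    have : x ∈ RingHom.ker φ ↔ x ∈ M.comap (Ideal.Quotient.mk I) := by rw [hker]
    exact this

/-- A finite disjoint union of spectra is the spectrum of the product. -/
theorem IsNoetherianSpectrum.sigma {n : ℕ} {U : Fin n → Type u} [∀ i, PartialOrder (U i)]
    {k : Type v} [Field k] (hU : ∀ i, IsNoetherianSpectrum.{w} (U i) k) :
    IsNoetherianSpectrum.{w} (Σ i, U i) k := by
  choose R hcomm hR e hk using hU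
  have e := fun i => (e i).some
  let F := PrimeSpectrum.sigmaToPi R
  have hF : Function.Bijective F := PrimeSpectrum.sigmaToPi_bijective R
  have hle : ∀ a b, F a ≤ F b ↔ a ≤ b := by
    rintro ⟨i, p⟩ ⟨j, q⟩
    constructor
    · intro h
      have hij : i = j := by
        by_contra hij
        have h1 : Pi.single j 1 ∈ (F ⟨i, p⟩).asIdeal := by
          simp [F, Pi.single_eq_of_ne hij]
        have h2 := h h1
        simp [F] at h2
        exact q.isPrime.ne_top ((Ideal.eq_top_iff_one _).2 h2)
      subst hij
      refine Sigma.mk_le_mk_iff.2 fun x hx => ?_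
      have h1 : Pi.single i x ∈ (F ⟨i, p⟩).asIdeal := by simpa [F] using hx
      simpa [F] using h h1
    · intro h
      cases h with
      | fiber i p q h => exact Ideal.comap_mono (f := Pi.evalRingHom R i) h
  refine ⟨∀ i, R i, inferInstance, inferInstance, ⟨?_⟩, ?_⟩
  · refine (RelIso.ofSurjective (OrderEmbedding.ofMapLEIff F hle) hF.2).symm.trans ?_
    refine
      { Equiv.sigmaCongrRight fun i => (e i).toEquiv with
        map_rel_iff' := ?_ }
    rintro ⟨i, p⟩ ⟨j, q⟩
    constructor
    · intro h
      by_cases hij : i = j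
      · subst hij
        exact Sigma.mk_le_mk_iff.2 ((e i).le_iff_le.1 (Sigma.mk_le_mk_iff.1 h))
      · obtain ⟨h1, -⟩ := Sigma.le_def.1 h
        exact absurd h1 hij
    · intro h
      cases h with
      | fiber i p q h => exact Sigma.mk_le_mk_iff.2 ((e i).monotone h)
  · intro M hM
    obtain ⟨⟨i, p⟩, hp⟩ := hF.2 ⟨M, hM.isPrime⟩
    have hpM : p.asIdeal.comap (Pi.evalRingHom R i) = M := congrArg PrimeSpectrum.asIdeal hp
    have hFmax : IsMax (F ⟨i, p⟩) := PrimeSpectrum.isMax_iff.2 (by rw [hp]; exact hM)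
    have hpmax : p.asIdeal.IsMaximal := PrimeSpectrum.isMax_iff.1 fun q hpq =>
      Sigma.mk_le_mk_iff.1 ((hle ⟨i, q⟩ ⟨i, p⟩).1
        (hFmax ((hle ⟨i, p⟩ ⟨i, q⟩).2 (Sigma.mk_le_mk_iff.2 hpq))))
    obtain ⟨φ, hφ, hker⟩ := exists_ringHom_ker_eq (hk i _ hpmax)
    refine nonempty_ringEquiv_of_ker_eq (φ.comp (Pi.evalRingHom R i))
      (hφ.comp (Function.surjective_eval i)) ?_
    rw [← hpM, ← RingHom.comap_ker, hker]

/-! ### Nodes that join minimal nodes, and branches of a maximal node -/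

open Order Cardinal

section Basic

variable {V : Type u} [PartialOrder V]

/-- A node joins minimal nodes if it dominates at least two of them. -/
def JoinsMin (x : V) : Prop :=
  ∃ a b : V, a ≠ b ∧ IsMin a ∧ IsMin b ∧ a < x ∧ b < x

theorem JoinsMin.not_isMin {x : V} (h : JoinsMin x) : ¬ IsMin x := by
  obtain ⟨a, -, -, -, -, ha, -⟩ := h
  exact fun hx => hx.not_lt ha

theorem height_eq_one_iff {x : V} : height x = 1 ↔ ¬ IsMin x ∧ ∀ y < x, IsMin y := by
  constructor
  · intro h
    refine ⟨fun hx => ?_, fun y hy => ?_⟩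
    · rw [hx.height_eq_zero] at h
      exact zero_ne_one h
    · by_contra hmin
      obtain ⟨z, hz⟩ := not_isMin_iff.1 hmin
      exact h.not_gt (one_lt_height_iff.2 ⟨y, z, hz, hy⟩)
  · rintro ⟨h1, h2⟩
    refine le_antisymm (not_lt.1 fun h => ?_) (Order.one_le_iff_ne_zero.2 (height_ne_zero.2 h1))
    obtain ⟨y, z, hz, hy⟩ := one_lt_height_iff.1 h
    exact (h2 y hy).not_lt hz

theorem isMin_of_lt_of_lt (hd : krullDim V ≤ 2) {x y z : V} (h1 : x < y) (h2 : y < z) :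
    IsMin x := by
  by_contra hx
  obtain ⟨t, ht⟩ := not_isMin_iff.1 hx
  have h3 : (height z : WithBot ℕ∞) ≤ 2 := (height_le_krullDim z).trans hd
  have h4 : height z ≤ 2 := WithBot.coe_le_coe.1 h3
  have h5 : (3 : ℕ∞) ≤ height z := by
    calc (3 : ℕ∞) ≤ height t + 1 + 1 + 1 := by
          rw [add_assoc, add_assoc]; norm_num
      _ ≤ height x + 1 + 1 := by gcongr; exact height_add_one_le ht
      _ ≤ height y + 1 := by gcongr; exact height_add_one_le h1
      _ ≤ height z := height_add_one_le h2
  exact absurd (h5.trans h4) (by norm_num)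

theorem isMax_of_lt_of_lt (hd : krullDim V ≤ 2) {x y z : V} (h1 : x < y) (h2 : y < z) :
    IsMax z := by
  by_contra hz
  obtain ⟨t, ht⟩ := not_isMax_iff.1 hz
  exact (isMin_of_lt_of_lt hd h2 ht).not_lt h1

theorem exists_isMin_lt (hd : krullDim V ≤ 2) {x : V} (hx : ¬ IsMin x) :
    ∃ a, IsMin a ∧ a < x := by
  obtain ⟨y, hy⟩ := not_isMin_iff.1 hx
  by_cases h : IsMin y
  · exact ⟨y, h, hy⟩
  · obtain ⟨z, hz⟩ := not_isMin_iff.1 h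
    exact ⟨z, isMin_of_lt_of_lt hd hz hy, hz.trans hy⟩

theorem isMin_coe_iff_Iic {m : V} {x : Set.Iic m} : IsMin x ↔ IsMin (x : V) := by
  constructor
  · intro h y hy
    exact h (b := ⟨y, hy.trans x.2⟩) hy
  · intro h y hy
    exact h hy

theorem joinsMin_coe_iff_Iic {m : V} {x : Set.Iic m} : JoinsMin x ↔ JoinsMin (x : V) := by
  constructor
  · rintro ⟨a, b, hab, ha, hb, hax, hbx⟩
    exact ⟨a, b, fun h => hab (Subtype.ext h), isMin_coe_iff_Iic.1 ha, isMin_coe_iff_Iic.1 hb,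
      hax, hbx⟩
  · rintro ⟨a, b, hab, ha, hb, hax, hbx⟩
    exact ⟨⟨a, hax.le.trans x.2⟩, ⟨b, hbx.le.trans x.2⟩, fun h => hab (congrArg Subtype.val h),
      isMin_coe_iff_Iic.2 ha, isMin_coe_iff_Iic.2 hb, hax, hbx⟩

/-- A criterion for simplicity at `m`: the node `c` is the only element of `Λ`. Either `c` is the
only minimal node below `m` and no node of height one below `m` joins minimal nodes, or `c` is the
only such joining node and all minimal nodes below `m` are below it. -/
theorem dNumber_eq_one {m c : V} (hcm : c < m) (hjoin : ∀ x < m, JoinsMin x → x = c)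
    (hmin : ∀ x < m, IsMin x → x ≤ c) (hc : IsMin c ∨ JoinsMin c ∧ ∀ y < c, IsMin y) :
    dNumber (⟨m, Set.mem_Iic.mpr le_rfl⟩ : Set.Iic m) = 1 := by
  have hset : lambdaNodes (⟨m, Set.mem_Iic.mpr le_rfl⟩ : Set.Iic m) = {⟨c, hcm.le⟩} := by
    refine Set.eq_singleton_iff_unique_mem.2 ⟨⟨⟨?_, fun h => hcm.ne (congrArg Subtype.val h)⟩, ?_⟩,
      ?_⟩
    · rcases hc with hc | ⟨hc, hc'⟩
      · exact Or.inl (isMin_coe_iff_Iic.2 hc)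
      · exact Or.inr ⟨height_eq_one_iff.2 ⟨fun h => hc.not_isMin (isMin_coe_iff_Iic.1 h),
          fun y hy => isMin_coe_iff_Iic.2 (hc' y hy)⟩, joinsMin_coe_iff_Iic.2 hc⟩
    · rcases hc with hc | ⟨hc, hc'⟩
      · right
        refine Set.eq_empty_of_forall_notMem ?_
        rintro y ⟨⟨-, hy1⟩, hyH, hym⟩
        have hy2 := (height_eq_one_iff.1 hy1).1
        have hy3 := joinsMin_coe_iff_Iic.1 (hyH.resolve_left hy2).2
        have := hjoin y (lt_of_le_of_ne y.2 fun h => hym (Subtype.ext h)) hy3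
        exact hy3.not_isMin (this ▸ hc)
      · exact Or.inl (height_eq_one_iff.2 ⟨fun h => hc.not_isMin (isMin_coe_iff_Iic.1 h),
          fun y hy => isMin_coe_iff_Iic.2 (hc' y hy)⟩)
    · rintro x ⟨⟨hxH, hxm⟩, hx⟩
      have hxlt : (x : V) < m := lt_of_le_of_ne x.2 fun h => hxm (Subtype.ext h)
      rcases hxH with hxH | ⟨-, hxH⟩
      · have hxmin := isMin_coe_iff_Iic.1 hxH
        by_contra hne
        have hlt : (x : V) < c := lt_of_le_of_ne (hmin x hxlt hxmin)
          fun h => hne (Subtype.ext h)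
        obtain ⟨hcj, hc'⟩ := hc.resolve_left fun h => h.not_lt hlt
        have hc1 : height (⟨c, hcm.le⟩ : Set.Iic m) = 1 :=
          height_eq_one_iff.2 ⟨fun h => hcj.not_isMin (isMin_coe_iff_Iic.1 h),
            fun y hy => isMin_coe_iff_Iic.2 (hc' y hy)⟩
        rcases hx with hx | hx
        · exact (height_eq_one_iff.1 hx).1 hxH
        · refine Set.eq_empty_iff_forall_notMem.1 hx ⟨c, hcm.le⟩ ⟨⟨hlt.le, hc1⟩,
            Or.inr ⟨hc1, joinsMin_coe_iff_Iic.2 hcj⟩, fun h => hcm.ne (congrArg Subtype.val h)⟩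
      · exact Subtype.ext (hjoin x hxlt (joinsMin_coe_iff_Iic.1 hxH))
  rw [dNumber, hset, Cardinal.mk_singleton]

/-- The nodes joining minimal nodes below `m`, and the minimal nodes below `m` that are below none
of them. -/
def branches (m : V) : Set V :=
  {x | x < m ∧ (JoinsMin x ∨ IsMin x ∧ ∀ y, JoinsMin y → x < y → ¬ y < m)}

theorem exists_branch_ge {m a : V} (ha : IsMin a) (ham : a < m) : ∃ l ∈ branches m, a ≤ l := by
  by_cases h : ∃ y, JoinsMin y ∧ a < y ∧ y < m
  · obtain ⟨y, hy, hay, hym⟩ := h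
    exact ⟨y, ⟨hym, Or.inl hy⟩, hay.le⟩
  · push Not at h
    exact ⟨a, ⟨ham, Or.inr ⟨ha, h⟩⟩, le_rfl⟩

/-- The branches of `m` form an antichain. -/
theorem eq_of_mem_branches_of_le (hd : krullDim V ≤ 2) {m x y : V} (hx : x ∈ branches m)
    (hy : y ∈ branches m) (h : x ≤ y) : x = y := by
  by_contra hne
  have hlt := lt_of_le_of_ne h hne
  rcases hx.2 with hx' | ⟨hx', hx''⟩
  · exact hx'.not_isMin (isMin_of_lt_of_lt hd hlt hy.1)
  · rcases hy.2 with hy' | ⟨hy', -⟩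
    · exact hx'' y hy' hlt hy.1
    · exact hy'.not_lt hlt

theorem IsKPoset.finite_joinsMin (hV : IsKPoset V) : {x : V | JoinsMin x ∧ ¬ IsMax x}.Finite := by
  have hfin : (⋃ p ∈ {p : V × V | IsMin p.1 ∧ IsMin p.2 ∧ p.1 ≠ p.2}, mub {p.1, p.2}).Finite := by
    refine Set.Finite.biUnion ((hV.finite_min.prod hV.finite_min).subset ?_) ?_
    · rintro p ⟨h1, h2, -⟩
      exact ⟨h1, h2⟩
    · rintro p ⟨h1, h2, h3⟩
      exact hV.finite_mub _ _ h1 h2 h3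
  refine hfin.subset ?_
  rintro x ⟨⟨a, b, hab, ha, hb, hax, hbx⟩, hx⟩
  refine Set.mem_biUnion (show (a, b) ∈ _ from ⟨ha, hb, hab⟩) ⟨?_, ?_⟩
  · simp [upperBounds, hax.le, hbx.le]
  · intro s hs hsx
    rcases hsx.eq_or_lt with rfl | hlt
    · exact le_rfl
    · obtain ⟨t, ht⟩ := not_isMax_iff.1 hx
      have hsmin := isMin_of_lt_of_lt hV.dim_le hlt ht
      have has : a ≤ s := hs (by simp)
      have hbs : b ≤ s := hs (by simp)
      exact absurd ((hsmin.eq_of_le has).trans (hsmin.eq_of_le hbs).symm) hab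

/-- Every branch lies in one finite set. -/
theorem branches_subset (m : V) :
    branches m ⊆ {x | IsMin x} ∪ {x : V | JoinsMin x ∧ ¬ IsMax x} := by
  rintro x ⟨hxm, hx | ⟨hx, -⟩⟩
  · exact Or.inr ⟨hx, fun h => h.not_lt hxm⟩
  · exact Or.inl hx

theorem IsKPoset.finite_branches (hV : IsKPoset V) (m : V) : (branches m).Finite :=
  (hV.finite_min.union hV.finite_joinsMin).subset (branches_subset m)

end Basic

section Distribution

/-- A map to a finite nonempty set all of whose fibres on a given infinite set are of full size. -/
theorem exists_equidistribution {V : Type u} (T L : Set V) (hL : L.Finite) (hL' : L.Nonempty) :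
    ∃ h : V → V, (∀ x, h x ∈ L) ∧
      (T.Infinite → ∀ l ∈ L, #{x : V | x ∈ T ∧ h x = l} = #T) := by
  classical
  obtain ⟨l₀, hl₀⟩ := hL'
  by_cases hT : T.Infinite
  · have hT' : ℵ₀ ≤ #T := by
      have := hT.to_subtype
      exact Cardinal.aleph0_le_mk T
    have hLT : #L ≤ #T := (hL.lt_aleph0.le).trans hT'
    have hne : #L ≠ 0 := by
      have : Nonempty L := ⟨⟨l₀, hl₀⟩⟩
      exact Cardinal.mk_ne_zero _
    have hcard : #T = #(T × L) := by
      rw [Cardinal.mk_prod, Cardinal.lift_id, Cardinal.lift_id,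
        Cardinal.mul_eq_left hT' hLT hne]
    obtain ⟨e⟩ := Cardinal.eq.1 hcard
    refine ⟨fun x => if hx : x ∈ T then (e ⟨x, hx⟩).2 else l₀, fun x => ?_, fun _ l hl => ?_⟩
    · dsimp only
      split_ifs
      · exact Subtype.coe_prop _
      · exact hl₀
    · refine le_antisymm (Cardinal.mk_le_mk_of_subset fun x hx => hx.1) ?_
      refine Cardinal.mk_le_of_injective
        (f := fun t : T => ⟨(e.symm (t, ⟨l, hl⟩)).1, (e.symm (t, ⟨l, hl⟩)).2, by simp⟩) ?_
      intro s t hst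
      have h0 := congrArg Subtype.val hst
      exact (Prod.ext_iff.1 (e.symm.injective (Subtype.ext h0))).1
  · exact ⟨fun _ => l₀, fun _ => hl₀, fun h => absurd h hT⟩

variable {V : Type u} [PartialOrder V]

/-- A distribution assigns to a node `x` below a maximal node `m` the branch `g m x` of `m` to
which `x` is attached when `m` is split. Branches are attached to themselves, the value at a
minimal node is that node, and each class `[m/a]` is shared out equally among the branches of `m`
above `a`. -/
structure IsDistribution (g : V → V → V) : Prop where
  of_isMin : ∀ m x, IsMin x → g m x = x
  of_joinsMin : ∀ m x, JoinsMin x → g m x = x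
  mem_branches : ∀ m x, x < m → ¬ IsMin x → g m x ∈ branches m
  le_apply : ∀ m x a, IsMin a → a < x → a ≤ g m x
  mk_class : ∀ m a l, IsMin a → l ∈ branches m → a ≤ l → (interClass {m} {a}).Infinite →
    #{x : V | x ∈ interClass {m} {a} ∧ g m x = l} = #(interClass {m} {a})

/-- A node that does not join minimal nodes is sent to a branch above the unique minimal node `b x`
below it. On each infinite class `[m/a]` this choice is made by an equidistribution. -/
theorem IsKPoset.exists_isDistribution (hV : IsKPoset V) : ∃ g : V → V → V, IsDistribution g := by
  classical
  have hh : ∀ m a : V, ∃ h : V → V, IsMin a → a < m → (∀ x, h x ∈ branches m ∧ a ≤ h x) ∧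
      ((interClass {m} {a}).Infinite → ∀ l ∈ branches m, a ≤ l →
        #{x : V | x ∈ interClass {m} {a} ∧ h x = l} = #(interClass {m} {a})) := by
    intro m a
    by_cases hma : IsMin a ∧ a < m
    · obtain ⟨h, h1, h2⟩ := exists_equidistribution (interClass {m} {a})
        {l | l ∈ branches m ∧ a ≤ l} ((hV.finite_branches m).subset fun x hx => hx.1)
        (exists_branch_ge hma.1 hma.2)
      exact ⟨h, fun _ _ => ⟨h1, fun hT l hl hal => h2 hT l ⟨hl, hal⟩⟩⟩
    · exact ⟨id, fun h1 h2 => absurd ⟨h1, h2⟩ hma⟩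
  choose h hh using hh
  have hb : ∀ x : V, ∃ a, ¬ IsMin x → IsMin a ∧ a < x := by
    intro x
    by_cases hx : IsMin x
    · exact ⟨x, fun h => absurd hx h⟩
    · obtain ⟨a, ha⟩ := exists_isMin_lt hV.dim_le hx
      exact ⟨a, fun _ => ha⟩
  choose b hb using hb
  have hbeq : ∀ x a, ¬ JoinsMin x → IsMin a → a < x → b x = a := by
    intro x a hx ha hax
    by_contra hne
    obtain ⟨h1, h2⟩ := hb x fun h => h.not_lt hax
    exact hx ⟨b x, a, hne, h1, ha, h2, hax⟩
  refine ⟨fun m x => if IsMin x ∨ JoinsMin x ∨ ¬ x < m then x else h m (b x) x, ?_, ?_, ?_, ?_, ?_⟩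
  · intro m x hx
    simp [hx]
  · intro m x hx
    simp [hx]
  · intro m x hxm hx
    by_cases hj : JoinsMin x
    · simp only [hj, true_or, or_true, if_true]
      exact ⟨hxm, Or.inl hj⟩
    · simp only [hx, hj, hxm, not_true, or_false, if_false]
      exact ((hh m (b x) (hb x hx).1 ((hb x hx).2.trans hxm)).1 x).1
  · intro m x a ha hax
    split_ifs with hcase
    · exact hax.le
    · push Not at hcase
      obtain ⟨hx, hj, hxm⟩ := hcase
      rw [hbeq x a hj ha hax]
      exact ((hh m a ha (hax.trans hxm)).1 x).2
  · intro m a l ha hl hal hT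
    rw [← (hh m a ha (hal.trans_lt hl.1)).2 hT l hl hal]
    congr 1
    have : ∀ x ∈ interClass {m} {a},
        (if IsMin x ∨ JoinsMin x ∨ ¬ x < m then x else h m (b x) x) = h m a x := by
      rintro x ⟨hx1, hx2⟩
      have hxm : x < m := by
        have : m ∈ Set.Ioi x := by rw [hx1]; rfl
        exact this
      have hax : a < x := by
        have : a ∈ Set.Iio x := by rw [hx2]; rfl
        exact this
      have hj : ¬ JoinsMin x := by
        rintro ⟨c, d, hcd, -, -, hc, hd⟩
        have hc' : c ∈ Set.Iio x := hc
        have hd' : d ∈ Set.Iio x := hd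
        rw [hx2] at hc' hd'
        exact hcd (hc'.trans hd'.symm)
      have hx : ¬ IsMin x := fun h => h.not_lt hax
      simp only [hx, hj, hxm, not_true, or_false, if_false]
      rw [hbeq x a hj ha hax]
    have hset : {x : V | x ∈ interClass {m} {a} ∧
        (if IsMin x ∨ JoinsMin x ∨ ¬ x < m then x else h m (b x) x) = l} =
        {x : V | x ∈ interClass {m} {a} ∧ h m a x = l} := by
      ext x
      simp only [Set.mem_ofPred_eq]
      exact and_congr_right fun hx => by rw [this x hx]
    rw [hset]

end Distribution

/-! ### Splitting the maximal nodes -/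

section Split

variable {V : Type u} [PartialOrder V]

/-- The poset obtained by splitting each maximal node `m` of positive height into one node `(m, l)`
for each branch `l` of `m`; any other node `x` is encoded as `(x, x)`. A node below `m` is placed
below exactly those `(m, l)` that the distribution `g` prescribes. -/
@[ext]
structure Split {g : V → V → V} (hV : IsKPoset V) (hg : IsDistribution g) : Type u where
  /-- The node of `V` from which the node arises. -/
  base : V
  /-- The branch of `base`, or `base` itself if that is not split. -/
  branch : V
  spec : (branch = base ∧ (IsMax base → IsMin base)) ∨ (IsMax base ∧ branch ∈ branches base)

namespace Split

variable {g : V → V → V} {hV : IsKPoset V} {hg : IsDistribution g}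

/-- Since the branches of a node form an antichain, a node `x` is below `(m, l)` if and only if
`x < m` and `g m x ≤ l`; for a node `m` that is not split the second condition is automatic. -/
instance : PartialOrder (Split hV hg) where
  le p q := p = q ∨ p.base < q.base ∧ g q.base p.base ≤ q.branch
  le_refl p := Or.inl rfl
  le_trans p q r := by
    rintro (rfl | ⟨h1, h2⟩) (rfl | ⟨h3, h4⟩)
    · exact Or.inl rfl
    · exact Or.inr ⟨h3, h4⟩
    · exact Or.inr ⟨h1, h2⟩
    · have hmin := isMin_of_lt_of_lt hV.dim_le h1 h3
      refine Or.inr ⟨h1.trans h3, ?_⟩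
      rw [hg.of_isMin _ _ hmin]
      exact (hg.le_apply _ _ _ hmin h1).trans h4
  le_antisymm p q := by
    rintro (rfl | ⟨h1, -⟩) (h | ⟨h3, -⟩)
    · rfl
    · rfl
    · exact h.symm
    · exact absurd (h1.trans h3) (lt_irrefl _)

theorem le_iff {p q : Split hV hg} :
    p ≤ q ↔ p = q ∨ p.base < q.base ∧ g q.base p.base ≤ q.branch := Iff.rfl

theorem lt_iff {p q : Split hV hg} :
    p < q ↔ p.base < q.base ∧ g q.base p.base ≤ q.branch := by
  rw [lt_iff_le_and_ne, le_iff]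
  constructor
  · rintro ⟨rfl | h, hne⟩
    · exact absurd rfl hne
    · exact h
  · rintro h
    exact ⟨Or.inr h, fun he => h.1.ne (by rw [he])⟩

theorem base_strictMono : StrictMono (base : Split hV hg → V) := fun _ _ h => (lt_iff.1 h).1

variable (hV hg) in
/-- The node of the split poset given by a node that is not split. -/
def node (x : V) (hx : IsMax x → IsMin x) : Split hV hg := ⟨x, x, Or.inl ⟨rfl, hx⟩⟩

theorem branch_eq {p : Split hV hg} (hp : IsMax p.base → IsMin p.base) : p.branch = p.base := by
  rcases p.spec with h | ⟨h1, h2⟩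
  · exact h.1
  · exact absurd (hp h1) fun h => h.not_lt h2.1

theorem branch_mem {p : Split hV hg} (hp : ¬ IsMin p.base) (hp' : IsMax p.base) :
    p.branch ∈ branches p.base := by
  rcases p.spec with h | ⟨h1, h2⟩
  · exact absurd (h.2 hp') hp
  · exact h2

theorem eq_node {p : Split hV hg} (hp : IsMax p.base → IsMin p.base) : p = node hV hg p.base hp :=
  Split.ext rfl (branch_eq hp)

theorem apply_of_mem_branches (hg : IsDistribution g) {m n l : V} (hl : l ∈ branches m) :
    g n l = l := by
  rcases hl.2 with h | ⟨h, -⟩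
  · exact hg.of_joinsMin _ _ h
  · exact hg.of_isMin _ _ h

theorem base_surjective : Function.Surjective (base : Split hV hg → V) := by
  intro x
  by_cases hx : IsMax x → IsMin x
  · exact ⟨node hV hg x hx, rfl⟩
  · push Not at hx
    obtain ⟨a, ha, hax⟩ := exists_isMin_lt hV.dim_le hx.2
    obtain ⟨l, hl, -⟩ := exists_branch_ge ha hax
    exact ⟨⟨x, l, Or.inr ⟨hx.1, hl⟩⟩, rfl⟩

/-- A relation between the underlying nodes lifts once the branch of the upper node is suitably
chosen. -/
theorem exists_le_of_base_le (p q : Split hV hg) (h : p.base ≤ q.base) :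
    ∃ q' : Split hV hg, p ≤ q' ∧ q'.base = q.base := by
  rcases h.eq_or_lt with h | h
  · exact ⟨p, le_rfl, h⟩
  · by_cases hq : IsMax q.base
    · by_cases hp : IsMin p.base
      · obtain ⟨l, hl, hpl⟩ := exists_branch_ge hp h
        exact ⟨⟨q.base, l, Or.inr ⟨hq, hl⟩⟩, Or.inr ⟨h, by rwa [hg.of_isMin _ _ hp]⟩, rfl⟩
      · exact ⟨⟨q.base, g q.base p.base, Or.inr ⟨hq, hg.mem_branches _ _ h hp⟩⟩,
          Or.inr ⟨h, le_rfl⟩, rfl⟩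
    · obtain ⟨t, ht⟩ := not_isMax_iff.1 hq
      have hp := isMin_of_lt_of_lt hV.dim_le h ht
      refine ⟨q, Or.inr ⟨h, ?_⟩, rfl⟩
      rw [hg.of_isMin _ _ hp, branch_eq fun h' => absurd h' hq]
      exact h.le

theorem isMin_base_iff {p : Split hV hg} : IsMin p.base ↔ IsMin p := by
  constructor
  · intro h
    rw [isMin_iff_forall_not_lt]
    exact fun q hq => h.not_lt (base_strictMono hq)
  · intro h
    by_contra hp
    rcases p.spec with ⟨h1, -⟩ | ⟨-, hl⟩
    · obtain ⟨a, ha, hap⟩ := exists_isMin_lt hV.dim_le hp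
      refine h.not_lt (b := node hV hg a fun _ => ha) (lt_iff.2 ⟨hap, ?_⟩)
      rw [h1]
      change g p.base a ≤ _
      rw [hg.of_isMin _ _ ha]
      exact hap.le
    · refine h.not_lt (b := node hV hg p.branch fun h => absurd hl.1 h.not_lt)
        (lt_iff.2 ⟨hl.1, ?_⟩)
      exact (apply_of_mem_branches hg hl).le

theorem isMax_base_iff {p : Split hV hg} : IsMax p.base ↔ IsMax p := by
  constructor
  · intro h
    rw [isMax_iff_forall_not_lt]
    exact fun q hq => h.not_lt (base_strictMono hq)
  · intro h
    rw [isMax_iff_forall_not_lt]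
    intro y hy
    obtain ⟨q, rfl⟩ := base_surjective (hV := hV) (hg := hg) y
    obtain ⟨q', hq', hqq'⟩ := exists_le_of_base_le p q hy.le
    have : p = q' := h.eq_of_le hq'
    rw [← hqq', this] at hy
    exact lt_irrefl _ hy

theorem finite_isMax (hmax : {x : V | IsMax x}.Finite) : {p : Split hV hg | IsMax p}.Finite := by
  have hinj : Function.Injective fun p : Split hV hg => (p.base, p.branch) := fun p q h =>
    Split.ext (Prod.ext_iff.1 h).1 (Prod.ext_iff.1 h).2
  refine (((hmax.prod (hmax.union (hV.finite_min.union hV.finite_joinsMin))).preimage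
    hinj.injOn)).subset ?_
  intro p hp
  have hp' := isMax_base_iff.2 hp
  refine ⟨hp', ?_⟩
  rcases p.spec with h | h
  · exact Or.inl (show IsMax p.branch by rwa [h.1])
  · exact Or.inr (branches_subset _ h.2)

theorem mk_eq (hinf : ℵ₀ ≤ #V) : #(Split hV hg) = #V := by
  refine le_antisymm ?_ (Cardinal.mk_le_of_surjective base_surjective)
  have hinj : Function.Injective fun p : Split hV hg => (p.base, p.branch) := fun p q h =>
    Split.ext (Prod.ext_iff.1 h).1 (Prod.ext_iff.1 h).2
  calc #(Split hV hg) ≤ #(V × V) := Cardinal.mk_le_of_injective hinj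
    _ = #V := by rw [Cardinal.mk_prod, Cardinal.lift_id, Cardinal.mul_eq_self hinf]

/-- The class of `((m, l), a)` contains the part of `[m/a]` that is attached to `l`, so it has full
cardinality. -/
theorem mk_interClass (hP : IsProperKPoset V) (hinf : ℵ₀ ≤ #V) {p q r : Split hV hg}
    (hrq : r < q) (hqp : q < p) : #(interClass {p} {r}) = #V := by
  refine le_antisymm ((Cardinal.mk_set_le _).trans (mk_eq hinf).le) ?_
  have hrq' := base_strictMono hrq
  have hqp' := base_strictMono hqp
  have hrmin := isMin_of_lt_of_lt hV.dim_le hrq' hqp'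
  have hpmax := isMax_of_lt_of_lt hV.dim_le hrq' hqp'
  have hpb : p.branch ∈ branches p.base := branch_mem (fun h => h.not_lt hqp') hpmax
  have hrl : r.base ≤ p.branch := by
    have := (lt_iff.1 (hrq.trans hqp)).2
    rwa [hg.of_isMin _ _ hrmin] at this
  have hT := hV.infinite_class _ _ _ hrq' hqp'
  have hTcard : #(interClass {p.base} {r.base}) = #V :=
    (hP.class_card _ _ hpmax hrmin).resolve_left fun h =>
      hT (by rw [Cardinal.mk_eq_zero_iff] at h; exact Set.toFinite _)
  rw [← hTcard, ← hg.mk_class _ _ _ hrmin hpb hrl hT]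
  have key : ∀ x ∈ {x : V | x ∈ interClass {p.base} {r.base} ∧ g p.base x = p.branch},
      ∃ hx : ¬ IsMax x, node hV hg x (fun h => absurd h hx) ∈ interClass {p} {r} := by
    rintro x ⟨⟨hx1, hx2⟩, hx3⟩
    have hxp : x < p.base := by
      have : p.base ∈ Set.Ioi x := by rw [hx1]; rfl
      exact this
    have hrx : r.base < x := by
      have : r.base ∈ Set.Iio x := by rw [hx2]; rfl
      exact this
    refine ⟨fun h => h.not_lt hxp, ?_, ?_⟩
    · refine Set.eq_singleton_iff_unique_mem.2 ⟨lt_iff.2 ⟨hxp, hx3.le⟩, ?_⟩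
      intro t ht
      obtain ⟨ht1, ht2⟩ := lt_iff.1 ht
      have htp : t.base = p.base := by
        have : t.base ∈ Set.Ioi x := ht1
        rw [hx1] at this
        exact this
      refine Split.ext htp ?_
      have htb : t.branch ∈ branches p.base :=
        htp ▸ branch_mem (fun h => h.not_lt ht1) (htp ▸ hpmax)
      change g t.base x ≤ t.branch at ht2
      rw [htp, hx3] at ht2
      exact (eq_of_mem_branches_of_le hV.dim_le hpb htb ht2).symm
    · refine Set.eq_singleton_iff_unique_mem.2 ⟨lt_iff.2 ⟨hrx, ?_⟩, ?_⟩
      · change g x r.base ≤ x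
        rw [hg.of_isMin _ _ hrmin]
        exact hrx.le
      · intro t ht
        have htr : t.base = r.base := by
          have : t.base ∈ Set.Iio x := (lt_iff.1 ht).1
          rw [hx2] at this
          exact this
        have hmin : ∀ s : Split hV hg, s.base = r.base → s.branch = r.base := fun s hs => by
          rw [branch_eq fun _ => by rwa [hs], hs]
        exact Split.ext htr ((hmin t htr).trans (hmin r rfl).symm)
  refine Cardinal.mk_le_of_injective
    (f := fun x => (⟨node hV hg x.1 _, (key x.1 x.2).2⟩ : interClass {p} {r})) ?_
  intro x y h
  exact Subtype.ext (congrArg (fun z : interClass {p} {r} => z.1.base) h)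

theorem isKPoset (hP : IsProperKPoset V) (hinf : ℵ₀ ≤ #V) (hmax : {x : V | IsMax x}.Finite) :
    IsKPoset (Split hV hg) where
  dim_le := (krullDim_le_of_strictMono base base_strictMono).trans hV.dim_le
  finite_min := by
    have hinj : Set.InjOn (base : Split hV hg → V) {p | IsMin p} := by
      intro p hp q hq h
      refine Split.ext h ?_
      rw [branch_eq fun _ => isMin_base_iff.2 hp, branch_eq fun _ => isMin_base_iff.2 hq, h]
    exact Set.Finite.of_finite_image (hV.finite_min.subset (by
      rintro _ ⟨p, hp, rfl⟩
      exact isMin_base_iff.2 hp)) hinj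
  finite_height_two := by
    refine (finite_isMax hmax).subset fun p hp => ?_
    have h1 : 1 < height p := by rw [show height p = 2 from hp]; norm_num
    obtain ⟨y, z, hz, hy⟩ := one_lt_height_iff.1 h1
    exact isMax_base_iff.1 (isMax_of_lt_of_lt hV.dim_le (base_strictMono hz) (base_strictMono hy))
  finite_mub := by
    intro x y hx hy hxy
    have hbase : ∀ p : Split hV hg, IsMin p → p.branch = p.base := fun p hp =>
      branch_eq fun _ => isMin_base_iff.2 hp
    have hxy' : x.base ≠ y.base := fun h => hxy (Split.ext h (by rw [hbase x hx, hbase y hy, h]))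
    have hfin := hV.finite_mub x.base y.base (isMin_base_iff.2 hx) (isMin_base_iff.2 hy) hxy'
    have hinj : Set.InjOn (base : Split hV hg → V) (mub {x, y} ∩ {p | ¬ IsMax p}) := by
      rintro p ⟨-, hp⟩ q ⟨-, hq⟩ h
      refine Split.ext h ?_
      rw [branch_eq fun h' => absurd (isMax_base_iff.1 h') hp,
        branch_eq fun h' => absurd (isMax_base_iff.1 h') hq, h]
    have hfin' : (mub {x, y} ∩ {p | ¬ IsMax p}).Finite := by
      refine Set.Finite.of_finite_image (hfin.subset ?_) hinj
      rintro _ ⟨z, ⟨hz, hzmax⟩, rfl⟩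
      have hxz : x ≤ z := hz.1 (by simp)
      have hyz : y ≤ z := hz.1 (by simp)
      refine ⟨?_, ?_⟩
      · simp [upperBounds, base_strictMono.monotone hxz, base_strictMono.monotone hyz]
      · intro t ht htz
        rcases htz.eq_or_lt with rfl | hlt
        · exact le_rfl
        · obtain ⟨s, hs⟩ := not_isMax_iff.1 hzmax
          have htmin := isMin_of_lt_of_lt hV.dim_le hlt (base_strictMono hs)
          have hxt : x.base ≤ t := ht (by simp)
          have hyt : y.base ≤ t := ht (by simp)
          exact absurd ((htmin.eq_of_le hxt).trans (htmin.eq_of_le hyt).symm) hxy'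
    refine (hfin'.union (finite_isMax hmax)).subset fun z hz => ?_
    by_cases h : IsMax z
    · exact Or.inr h
    · exact Or.inl ⟨hz, h⟩
  infinite_class := by
    intro x y z hzy hyx
    rw [← Set.infinite_coe_iff, Cardinal.infinite_iff, mk_interClass hP hinf hzy hyx]
    exact hinf

theorem isSimpleProperKPoset (hP : IsProperKPoset V) (hinf : ℵ₀ ≤ #V)
    (hmax : {x : V | IsMax x}.Finite) : IsSimpleProperKPoset (Split hV hg) where
  toIsKPoset := isKPoset hP hinf hmax
  class_card := by
    intro x z _ _
    by_cases h : (interClass {x} {z}).Nonempty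
    · obtain ⟨y, hy1, hy2⟩ := h
      have hyx : x ∈ Set.Ioi y := by rw [hy1]; rfl
      have hzy : z ∈ Set.Iio y := by rw [hy2]; rfl
      exact Or.inr ((mk_interClass hP hinf hzy hyx).trans (mk_eq hinf).symm)
    · rw [Set.not_nonempty_iff_eq_empty.1 h]
      exact Or.inl (Cardinal.mk_eq_zero _)
  d_eq_one := by
    intro m hm hpos
    have hmbase : ¬ IsMin m.base := fun h => height_pos.1 hpos (isMin_base_iff.1 h)
    have hmmax : IsMax m.base := isMax_base_iff.2 hm
    have hl : m.branch ∈ branches m.base := branch_mem hmbase hmmax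
    set c : Split hV hg := node hV hg m.branch fun h => absurd hl.1 h.not_lt with hc
    have heq : ∀ x : Split hV hg, x < m → x.base = m.branch → x = c := by
      intro x hx h
      refine Split.ext h ?_
      rw [branch_eq fun h' => absurd (base_strictMono hx) h'.not_lt, h]
      rfl
    refine dNumber_eq_one (c := c) (lt_iff.2 ⟨hl.1, (apply_of_mem_branches hg hl).le⟩) ?_ ?_ ?_
    · intro x hx hj
      obtain ⟨hx1, hx2⟩ := lt_iff.1 hx
      have hj' : JoinsMin x.base := by
        obtain ⟨a, b, hab, ha, hb, hax, hbx⟩ := hj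
        have ha' := isMin_base_iff.2 ha
        have hb' := isMin_base_iff.2 hb
        exact ⟨a.base, b.base, fun h => hab (Split.ext h (by
          rw [branch_eq fun _ => ha', branch_eq fun _ => hb', h])), ha', hb',
          base_strictMono hax, base_strictMono hbx⟩
      rw [hg.of_joinsMin _ _ hj'] at hx2
      exact heq x hx (eq_of_mem_branches_of_le hV.dim_le ⟨hx1, Or.inl hj'⟩ hl hx2)
    · intro x hx hmin
      have hmin' := isMin_base_iff.2 hmin
      have hx2 := (lt_iff.1 hx).2
      rw [hg.of_isMin _ _ hmin'] at hx2
      rcases hx2.eq_or_lt with h | h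
      · exact (heq x hx h).le
      · refine Or.inr ⟨h, ?_⟩
        rw [hg.of_isMin _ _ hmin']
        exact hx2
    · rcases hl.2 with ⟨a, b, hab, ha, hb, hal, hbl⟩ | ⟨h, -⟩
      · right
        refine ⟨⟨node hV hg a fun _ => ha, node hV hg b fun _ => hb,
          fun h => hab (congrArg base h), isMin_base_iff.1 ha, isMin_base_iff.1 hb,
          lt_iff.2 ⟨hal, ?_⟩, lt_iff.2 ⟨hbl, ?_⟩⟩, fun y hy => ?_⟩
        · exact (hg.of_isMin _ _ ha).le.trans hal.le
        · exact (hg.of_isMin _ _ hb).le.trans hbl.le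
        · exact isMin_base_iff.1 (isMin_of_lt_of_lt hV.dim_le (base_strictMono hy) hl.1)
      · exact Or.inl (isMin_base_iff.1 h)

end Split

/-- Splitting the maximal nodes of an infinite `V` does not change its cardinality, so the hypothesis
applies to the split poset, and gluing recovers `V`. -/
theorem isNoetherianSpectrum_of_infinite {β : Cardinal.{u}} {k : Type v} [Field k]
    (hsimple : ∀ (U : Type u) [PartialOrder U], IsSimpleProperKPoset U →
      #U = β → {x : U | IsMax x}.Finite → IsNoetherianSpectrum.{w} U k)
    (hP : IsProperKPoset V) (hβ : #V = β) (hmax : {x : V | IsMax x}.Finite)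
    (hinf : ℵ₀ ≤ #V) : IsNoetherianSpectrum.{w} V k := by
  have hV := hP.toIsKPoset
  obtain ⟨g, hg⟩ := hV.exists_isDistribution
  have hfin := Split.finite_isMax (hV := hV) (hg := hg) hmax
  refine (hsimple (Split hV hg) (Split.isSimpleProperKPoset hP hinf hmax)
    ((Split.mk_eq hinf).trans hβ) hfin).of_glue hfin Split.base
    Split.base_strictMono.monotone Split.base_surjective Split.exists_le_of_base_le ?_
  intro p q h
  by_cases hp : IsMax p.base
  · exact Or.inr ⟨Split.isMax_base_iff.1 hp, Split.isMax_base_iff.1 (h ▸ hp)⟩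
  · refine Or.inl (Split.ext h ?_)
    rw [Split.branch_eq fun h' => absurd h' hp, Split.branch_eq fun h' => absurd h' (h ▸ hp), h]

end Split

/-! ### Finite posets -/

section Star

variable {V : Type u} [PartialOrder V]

/-- The nodes of `V`, ordered so that the upper set of `a` is kept and all other nodes are
isolated. -/
@[ext]
structure Star (a : V) : Type u where
  /-- The underlying node of `V`. -/
  val : V

namespace Star

variable {a : V}

instance : PartialOrder (Star a) where
  le x y := x = y ∨ x.val = a ∧ a ≤ y.val
  le_refl x := Or.inl rfl
  le_trans x y z := by
    rintro (rfl | ⟨h1, h2⟩) (rfl | ⟨h3, h4⟩)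
    · exact Or.inl rfl
    · exact Or.inr ⟨h3, h4⟩
    · exact Or.inr ⟨h1, h2⟩
    · exact Or.inr ⟨h1, h4⟩
  le_antisymm x y := by
    rintro (rfl | ⟨h1, h2⟩) (h | ⟨h3, h4⟩)
    · rfl
    · rfl
    · exact h.symm
    · exact Star.ext (h1.trans h3.symm)

theorem le_iff {x y : Star a} : x ≤ y ↔ x = y ∨ x.val = a ∧ a ≤ y.val := Iff.rfl

theorem val_eq_of_lt {x y : Star a} (h : x < y) : x.val = a :=
  ((le_iff.1 h.le).resolve_left h.ne).1

theorem not_lt_of_lt {x y z : Star a} (h : x < y) : ¬ y < z := by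
  intro h'
  have h1 := val_eq_of_lt h
  have h2 := val_eq_of_lt h'
  exact h.ne (Star.ext (h1.trans h2.symm))

theorem isMin_of_lt {x y : Star a} (h : x < y) : IsMin x :=
  isMin_iff_forall_not_lt.2 fun _ hz => not_lt_of_lt hz h

/-- The nodes of `Star a` and those of `V` correspond. -/
def equiv (a : V) : Star a ≃ V := ⟨Star.val, Star.mk, fun _ => rfl, fun _ => rfl⟩

theorem height_le_one (x : Star a) : height x ≤ 1 :=
  not_lt.1 fun h => by
    obtain ⟨y, z, hz, hy⟩ := one_lt_height_iff.1 h
    exact not_lt_of_lt hz hy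

theorem isSimpleProperKPoset [Finite V] (a : V) : IsSimpleProperKPoset (Star a) := by
  have hfin : Finite (Star a) := Finite.of_equiv V (equiv a).symm
  refine ⟨⟨⟨?_, Set.toFinite _, Set.toFinite _, fun _ _ _ _ _ => Set.toFinite _,
    fun x y z h1 h2 => absurd h2 (not_lt_of_lt h1)⟩, fun x z _ _ => Or.inl ?_⟩, ?_⟩
  · rw [krullDim_eq_iSup_height]
    exact iSup_le fun x => WithBot.coe_le_coe.2 ((height_le_one x).trans (by norm_num))
  · rw [Cardinal.mk_eq_zero_iff, Set.isEmpty_coe_sort, Set.eq_empty_iff_forall_notMem]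
    rintro y ⟨hy1, hy2⟩
    have hyx : x ∈ Set.Ioi y := by rw [hy1]; rfl
    have hzy : z ∈ Set.Iio y := by rw [hy2]; rfl
    exact not_lt_of_lt hzy hyx
  · intro m _ hpos
    obtain ⟨c, hc⟩ := not_isMin_iff.1 (height_pos.1 hpos)
    have huniq : ∀ x < m, x = c := by
      intro x hx
      have h1 := val_eq_of_lt hx
      have h2 := val_eq_of_lt hc
      exact Star.ext (h1.trans h2.symm)
    exact dNumber_eq_one hc (fun x hx _ => huniq x hx) (fun x hx _ => (huniq x hx).le)
      (Or.inl (isMin_of_lt hc))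

/-- The upper set of `a` in `V`, if it is of dimension at most one, is an upper set of `Star a`. -/
def iciIso (a : V) (ha : ∀ x y, a < x → ¬ x < y) : Set.Ici (Star.mk a : Star a) ≃o Set.Ici a where
  toFun x := ⟨x.1.val, by
    rcases le_iff.1 x.2 with h | h
    · rw [← h]; exact le_refl a
    · exact h.2⟩
  invFun x := ⟨⟨x.1⟩, Or.inr ⟨rfl, x.2⟩⟩
  left_inv _ := rfl
  right_inv _ := rfl
  map_rel_iff' := by
    rintro ⟨⟨x⟩, hx⟩ ⟨⟨y⟩, hy⟩
    change x ≤ y ↔ (Star.mk x : Star a) ≤ ⟨y⟩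
    have hax : a ≤ x := by
      rcases le_iff.1 hx with h | h
      · cases h; exact le_rfl
      · exact h.2
    constructor
    · intro h
      rcases hax.eq_or_lt with rfl | hlt
      · exact Or.inr ⟨rfl, h⟩
      · rcases h.eq_or_lt with rfl | h
        · exact le_rfl
        · exact absurd h (ha _ _ hlt)
    · intro h
      rcases le_iff.1 h with h | ⟨h1, h2⟩
      · cases h; exact le_rfl
      · exact (show x = a from h1).le.trans h2

end Star

/-- Splitting the maximal nodes of a finite `V` would change its cardinality, so the stars of its
minimal nodes, padded to the size of `V` with isolated nodes, are realized separately. -/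
theorem isNoetherianSpectrum_of_finite [Finite V] {β : Cardinal.{u}} {k : Type v} [Field k]
    (hsimple : ∀ (U : Type u) [PartialOrder U], IsSimpleProperKPoset U →
      #U = β → {x : U | IsMax x}.Finite → IsNoetherianSpectrum.{w} U k)
    (hV : IsKPoset V) (hβ : #V = β) : IsNoetherianSpectrum.{w} V k := by
  have hdim : ∀ x y z : V, x < y → ¬ y < z := fun x y z h1 h2 =>
    hV.infinite_class z y x h1 h2 (Set.toFinite _)
  have hIci : ∀ a : V, IsNoetherianSpectrum.{w} (Set.Ici a) k := by
    intro a
    have hfin : Finite (Star a) := Finite.of_equiv V (Star.equiv a).symm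
    exact ((hsimple (Star a) (Star.isSimpleProperKPoset a)
      ((Cardinal.mk_congr (Star.equiv a)).trans hβ) (Set.toFinite _)).Ici ⟨a⟩).congr
      (Star.iciIso a fun x y => hdim a x y)
  -- indexing by `Fin n` keeps the product of the rings in their universe
  obtain ⟨n, ⟨e⟩⟩ := Finite.exists_equiv_fin {a : V // IsMin a}
  let U : Fin n → Type u := fun i => Set.Ici (e.symm i).1
  have hmono : ∀ p q : Σ i, U i, p ≤ q → p.2.1 ≤ q.2.1 := by
    rintro _ _ ⟨i, x, y, h⟩
    exact h
  refine IsNoetherianSpectrum.of_glue (U := Σ i, U i)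
    (IsNoetherianSpectrum.sigma fun i => hIci _) (Set.toFinite _) (fun p => p.2.1) hmono ?_ ?_ ?_
  · intro x
    have : ∃ a, IsMin a ∧ a ≤ x := by
      by_cases hx : IsMin x
      · exact ⟨x, hx, le_rfl⟩
      · obtain ⟨a, ha, hax⟩ := exists_isMin_lt hV.dim_le hx
        exact ⟨a, ha, hax.le⟩
    obtain ⟨a, ha, hax⟩ := this
    exact ⟨⟨e ⟨a, ha⟩, ⟨x, by simpa using hax⟩⟩, rfl⟩
  · rintro ⟨i, x⟩ ⟨j, y⟩ h
    have hxy : x.1 ≤ y.1 := h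
    exact ⟨⟨i, ⟨y.1, le_trans x.2 hxy⟩⟩, Sigma.mk_le_mk_iff.2 hxy, rfl⟩
  · -- a node above two different minimal nodes is maximal
    rintro ⟨i, x, hx⟩ ⟨j, y, hy⟩ h
    obtain rfl : x = y := h
    by_cases hij : i = j
    · subst hij
      exact Or.inl rfl
    · right
      have hne : (e.symm i).1 ≠ (e.symm j).1 := fun h => hij (e.symm.injective (Subtype.ext h))
      have hlt : ∀ i j, (e.symm i).1 ≠ (e.symm j).1 → (e.symm i).1 ≤ x → (e.symm j).1 ≤ x →
          (e.symm i).1 < x := by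
        intro i j hne hi hj
        refine lt_of_le_of_ne hi fun h => hne ?_
        exact ((e.symm i).2.eq_of_le (hj.trans h.ge)).symm
      have hmax : ∀ i, ∀ h : (e.symm i).1 ≤ x, (e.symm i).1 < x →
          IsMax (⟨i, ⟨x, h⟩⟩ : Σ i, U i) := by
        rintro i h hlt' _ ⟨_, _, z, hz⟩
        have hxz : x ≤ z.1 := hz
        rcases hxz.eq_or_lt with h' | h'
        · exact Sigma.mk_le_mk_iff.2 (show z.1 ≤ x from h'.ge)
        · exact absurd h' (hdim _ _ _ hlt')
      exact ⟨hmax i hx (hlt i j hne hx hy), hmax j hy (hlt j i hne.symm hy hx)⟩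

end Star

end KPoset

theorem mainTheorem7 (β : Cardinal.{u}) (k : Type v) [Field k]
    (hsimple : ∀ (U : Type u) [PartialOrder U], KPoset.IsSimpleProperKPoset U →
      Cardinal.mk U = β → {x : U | IsMax x}.Finite →
      KPoset.IsNoetherianSpectrum.{w} U k) :
    ∀ (V : Type u) [PartialOrder V], KPoset.IsProperKPoset V →
      Cardinal.mk V = β → {x : V | IsMax x}.Finite →
      KPoset.IsNoetherianSpectrum.{w} V k := by
  intro V _ hV hβ hmax
  rcases finite_or_infinite V with h | h
  · exact KPoset.isNoetherianSpectrum_of_finite hsimple hV.toIsKPoset hβ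
  · exact KPoset.isNoetherianSpectrum_of_infinite hsimple hV hβ hmax (Cardinal.aleph0_le_mk V)
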